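/- Fix $k\ge 2$ and distinct real colors $c_1,\dots,c_k$, independent of $n$. A coloring of $[n]=\{1,\dots,n\}$ is a map $x:[n]\to\{c_1,\dots,c_k\}$; let $\Omega$ be the set of all colorings and, for $n_1+\dots+n_k=n$, let $\Omega_{n_1,\dots,n_k}$ be the set of colorings with $|x^{-1}(c_i)|=n_i$ for all $i$. For a coloring $x$ let $\mathbf G(x)$ be the $n\times n$ matrix with entries $\mathbf G_{ij}(x)=x(i)-x(j)$. For each $n$ let $y=y^{(n)}$ be the true coloring, with class sizes $n_i=n_i(y)=|y^{-1}(c_i)|$, and assume that there is a constant $c>0$ independent of $n$ such that $\min_i n_i\ge cn$ for all sufficiently large $n$. Observe $$\mathbf T=\mathbf G(y)+\sigma\mathbf W,$$ where $\mathbf W$ is an $n\times n$ random matrix with i.i.d. standard Gaussian entries and $\sigma=\sigma_n\in\mathbb R$ is deterministic and may depend on $n$. Let $\|\cdot\|_F$ denote the Frobenius norm, and let $$\hat y\in\operatorname*{argmin}_{x\in\Omega_{n_1,\dots,n_k}}\|\mathbf T-\mathbf G(x)\|_F^2,\qquad \check y\in\operatorname*{argmin}_{x\in\Omega}\|\mathbf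 T-\mathbf G(x)\|_F^2$$ be the maximum likelihood estimators over the colorings with the prescribed class sizes and over all colorings (ties broken arbitrarily). Then: 1. If there is a constant $\delta>0$ independent of $n$ such that, for all sufficiently large $n$, $$\sigma^2<\frac{(1-\delta)\,n\,\min_{1\le i<j\le k}(c_i-c_j)^2}{4\log n},$$ then $\lim_{n\to\infty}\Pr(\hat y=y)=1$ and $\lim_{n\to\infty}\Pr(\check y=y)=1$. 2. If there is a constant $\delta>0$ independent of $n$ such that, for all sufficiently large $n$, $$\sigma^2>\frac{(1+\delta)\,n\,\min_{1\le i<j\le k}(c_i-c_j)^2}{4\log n},$$ then $\lim_{n\to\infty}\Pr(\hat y=y)=0$ and $\lim_{n\to\infty}\Pr(\check y=y)=0$. -/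

import Mathlib

open MeasureTheory ProbabilityTheory Filter Topology

namespace ColorRecovery

/-- Color assignment mappings of `n` vertices; the vertex `a` gets the real color `c (x a)`
when the `k` distinct real colors are `c : Fin k → ℝ`. -/
abbrev Coloring (n k : ℕ) : Type := Fin n → Fin k

/-- The number of vertices of color `i` under `x`. -/
def classSize {n k : ℕ} (x : Coloring n k) (i : Fin k) : ℕ :=
  (Finset.univ.filter fun a => x a = i).card

/-- The colorings whose `i`-th class has exactly `m i` vertices, for every color `i`. -/
def fixedSizes (n : ℕ) {k : ℕ} (m : Fin k → ℕ) : Set (Coloring n k) :=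
  {x | ∀ i, classSize x i = m i}

/-- The matrix of color differences of a coloring. -/
def diffMatrix {n k : ℕ} (c : Fin k → ℝ) (x : Coloring n k) : Matrix (Fin n) (Fin n) ℝ :=
  Matrix.of fun a b => c (x a) - c (x b)

/-- The square of the Frobenius norm of a real matrix. -/
def frobeniusSq {n : ℕ} (A : Matrix (Fin n) (Fin n) ℝ) : ℝ :=
  ∑ a, ∑ b, |A a b| ^ 2

/-- `x` is a minimizer, over the sample space `S`, of the squared Frobenius distance between
the observation `T` and the matrix of color differences: a value of the maximum likelihood
estimator over `S` at the observation `T`. -/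
def IsMLE {n k : ℕ} (c : Fin k → ℝ) (S : Set (Coloring n k)) (T : Matrix (Fin n) (Fin n) ℝ)
    (x : Coloring n k) : Prop :=
  x ∈ S ∧ IsMinOn (fun z => frobeniusSq (T - diffMatrix c z)) S x

/-- `W` is a random `n × n` matrix with i.i.d. standard Gaussian entries. -/
def IsStdGaussianMatrix {n : ℕ} {Ω : Type*} [MeasurableSpace Ω] (P : Measure Ω)
    (W : Ω → Matrix (Fin n) (Fin n) ℝ) : Prop :=
  iIndepFun (fun (p : Fin n × Fin n) (ω : Ω) => W ω p.1 p.2) P ∧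
    ∀ a b, HasLaw (fun ω => W ω a b) (gaussianReal 0 1) P

/-- The minimum over `i < j` of `(c i - c j) ^ 2` (a minimum over a finite set, which is nonempty
for at least two colors). -/
noncomputable def minSqGap {k : ℕ} (c : Fin k → ℝ) : ℝ :=
  ⨅ p : {p : Fin k × Fin k // p.1 < p.2}, (c p.1.1 - c p.1.2) ^ 2

end ColorRecovery

/-! Replacing the true coloring `y` by `z` changes the loss by `D + 2σ⟨A, W⟩`, where `A` is the
difference of the two color matrices and `D = ‖A‖²` is `sqDist`. This is Gaussian with mean `D` and
variance `4σ²D`, so `z` does at least as well as `y` with probability at most `exp(-D / (8σ²))`.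

Below the threshold a union bound over all `z` suffices. Let `h` be the number of recolored vertices
and `m` the minimal squared gap. Always `D ≥ 2h(n - h)m`, and since every class is large, also `D ≥
hκnm`. For `h ≤ δn/2` the first bound gives `n^(-(1+δ/2)h)`, which sums to `(1 + (k-1)n^(-1-δ/2))^n
- 1 → 0`. For larger `h` the second gives `n^(-κδn/4)`, which beats the `k^n` colorings.

Above the threshold, swapping `a` and `b` from two classes at the minimal gap `g` already improves
on `y`. It preserves class sizes and changes the loss by `4ng² + 2σg(R_a - R_b)`, with `R_p` the
`p`-th row sum minus the `p`-th column sum of `W`. A common shift makes the `R_p` independent `N(0,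
2n)` without altering differences, so the extremes over the two classes, of order `√(2n)·√(2 log n)`
and opposite sign, make the change negative.

Each half controls one event that serves both estimators. -/

namespace ColorRecovery

/-! ### Linear forms and tail bounds for standard Gaussian families. -/

section Gaussian

variable {Ω ι : Type*} [MeasurableSpace Ω] {P : Measure Ω} [Fintype ι] {X : ι → Ω → ℝ}

lemma hasGaussianLaw_linear (hind : iIndepFun X P)
    (hlaw : ∀ i, HasLaw (X i) (gaussianReal 0 1) P) {J : Type*} [Finite J] (a : J → ι → ℝ) :
    HasGaussianLaw (fun ω j => ∑ i, a j i * X i ω) P := by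
  have := Fintype.ofFinite J
  have hX : HasGaussianLaw (fun ω => (X · ω)) P :=
    hind.hasGaussianLaw fun i => (hlaw i).hasGaussianLaw
  exact hX.map_fun (ContinuousLinearMap.pi fun j =>
    ∑ i, a j i • ContinuousLinearMap.proj (R := ℝ) (φ := fun _ : ι => ℝ) i) |>.congr
      (by filter_upwards with ω; ext j; simp)

lemma covariance_linear (hind : iIndepFun X P)
    (hlaw : ∀ i, HasLaw (X i) (gaussianReal 0 1) P) (a b : ι → ℝ) :
    cov[fun ω => ∑ i, a i * X i ω, fun ω => ∑ i, b i * X i ω; P] = ∑ i, a i * b i := by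
  classical
  have := hind.isProbabilityMeasure
  have hL : ∀ i, MemLp (X i) 2 P := fun i => (hlaw i).hasGaussianLaw.memLp_two
  rw [covariance_fun_sum_fun_sum (fun i => (hL i).const_mul _) (fun i => (hL i).const_mul _)]
  refine Finset.sum_congr rfl fun i _ => ?_
  rw [Finset.sum_eq_single i]
  · rw [covariance_const_mul_left, covariance_const_mul_right, covariance_self (hL i).aemeasurable,
      (hlaw i).variance_eq, variance_id_gaussianReal]
    simp
  · intro j _ hij
    rw [covariance_const_mul_left, covariance_const_mul_right,
      (hind.indepFun hij.symm).covariance_eq_zero (hL i) (hL j)]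
    simp
  · simp

lemma hasLaw_linear (hind : iIndepFun X P)
    (hlaw : ∀ i, HasLaw (X i) (gaussianReal 0 1) P) (a : ι → ℝ) :
    HasLaw (fun ω => ∑ i, a i * X i ω) (gaussianReal 0 (∑ i, a i ^ 2).toNNReal) P := by
  have hg : HasGaussianLaw (fun ω => ∑ i, a i * X i ω) P :=
    (hasGaussianLaw_linear hind hlaw (fun _ : Unit => a)).eval ()
  refine ⟨hg.aemeasurable, ?_⟩
  rw [hg.map_eq_gaussianReal]
  congr 1
  · rw [integral_finsetSum _ fun i _ => (hlaw i).hasGaussianLaw.integrable.const_mul _]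
    refine Finset.sum_eq_zero fun i _ => ?_
    rw [integral_const_mul, (hlaw i).integral_eq]
    simp
  · rw [← covariance_self hg.aemeasurable, covariance_linear hind hlaw]
    simp [sq]

lemma iIndepFun_linear (hind : iIndepFun X P)
    (hlaw : ∀ i, HasLaw (X i) (gaussianReal 0 1) P) {J : Type*} [Finite J] (a : J → ι → ℝ)
    (hort : ∀ j l, j ≠ l → ∑ i, a j i * a l i = 0) :
    iIndepFun (fun j ω => ∑ i, a j i * X i ω) P :=
  (hasGaussianLaw_linear hind hlaw a).iIndepFun_of_covariance_eq_zero fun j l hjl => by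
    rw [covariance_linear hind hlaw, hort j l hjl]

/-- The Chernoff bound for a centered Gaussian variable. -/
lemma measure_ge_le_of_hasLaw {Y : Ω → ℝ} {v : NNReal} (hY : HasLaw Y (gaussianReal 0 v) P)
    {ε : ℝ} (hε : 0 ≤ ε) : P {ω | ε ≤ Y ω} ≤ ENNReal.ofReal (Real.exp (-ε ^ 2 / (2 * v))) := by
  have := hY.isProbabilityMeasure
  have h : HasSubgaussianMGF id v (gaussianReal 0 v) :=
    ⟨fun t => integrable_exp_mul_gaussianReal t, fun t => by simp [mgf_id_gaussianReal]⟩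
  have h2 := h.measure_ge_le hε
  rw [hY.measure_eq (p := fun x => ε ≤ x) measurableSet_Ici, ← ofReal_measureReal]
  exact ENNReal.ofReal_le_ofReal h2

/-- A lower bound for the Gaussian upper tail. -/
lemma gaussianReal_Ioi_ge {t : ℝ} (ht : 0 ≤ t) :
    ENNReal.ofReal ((√(2 * Real.pi))⁻¹ * Real.exp (-(t + 1) ^ 2 / 2)) ≤
      gaussianReal 0 1 (Set.Ioi t) := by
  rw [gaussianReal_apply 0 one_ne_zero]
  -- On `(t, t + 1]` the density is at least its value at `t + 1`. This crude bound is enough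
  -- because the slack `δ` absorbs the shift from `t` to `t + 1`.
  calc _ = ∫⁻ x in Set.Ioc t (t + 1),
        ENNReal.ofReal ((√(2 * Real.pi))⁻¹ * Real.exp (-(t + 1) ^ 2 / 2)) := by simp
    _ ≤ ∫⁻ x in Set.Ioc t (t + 1), gaussianPDF 0 1 x := by
        refine setLIntegral_mono (measurable_gaussianPDF 0 1) fun x hx => ?_
        rw [gaussianPDF, gaussianPDFReal]
        have := hx.1
        have := hx.2
        simp only [NNReal.coe_one, mul_one, sub_zero]
        gcongr
        linarith
    _ ≤ _ := lintegral_mono_set Set.Ioc_subset_Ioi_self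

end Gaussian

/-! ### The loss difference and lower bounds for the distance between color matrices. -/

section Loss

variable {n k : ℕ}

lemma minSqGap_le (c : Fin k → ℝ) {i j : Fin k} (hij : i ≠ j) : minSqGap c ≤ (c i - c j) ^ 2 := by
  have hb : BddBelow (Set.range fun p : {p : Fin k × Fin k // p.1 < p.2} =>
      (c p.1.1 - c p.1.2) ^ 2) := (Set.finite_range _).bddBelow
  rcases lt_or_gt_of_ne hij with h | h
  · exact ciInf_le hb ⟨(i, j), h⟩
  · exact (ciInf_le hb ⟨(j, i), h⟩).trans_eq (by ring)

lemma exists_minSqGap_eq (hk : 2 ≤ k) (c : Fin k → ℝ) :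
    ∃ i j : Fin k, i ≠ j ∧ minSqGap c = (c i - c j) ^ 2 := by
  have : Nonempty {p : Fin k × Fin k // p.1 < p.2} :=
    ⟨⟨(⟨0, by omega⟩, ⟨1, by omega⟩), by simp⟩⟩
  obtain ⟨p, hp⟩ := exists_eq_ciInf_of_finite
    (f := fun p : {p : Fin k × Fin k // p.1 < p.2} => (c p.1.1 - c p.1.2) ^ 2)
  exact ⟨p.1.1, p.1.2, p.2.ne, hp.symm⟩

lemma minSqGap_pos (hk : 2 ≤ k) {c : Fin k → ℝ} (hc : Function.Injective c) : 0 < minSqGap c := by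
  obtain ⟨i, j, hij, h⟩ := exists_minSqGap_eq hk c
  rw [h]
  have := sub_ne_zero.2 (hc.ne hij)
  positivity

/-- The squared Frobenius distance between the matrices of color differences of `y` and `z`. -/
def sqDist (c : Fin k → ℝ) (y z : Coloring n k) : ℝ :=
  ∑ p : Fin n × Fin n, ((c (y p.1) - c (z p.1)) - (c (y p.2) - c (z p.2))) ^ 2

lemma sqDist_nonneg (c : Fin k → ℝ) (y z : Coloring n k) : 0 ≤ sqDist c y z :=
  Finset.sum_nonneg fun _ _ => sq_nonneg _

lemma loss_sub_loss (c : Fin k → ℝ) (y z : Coloring n k) (s : ℝ) (w : Matrix (Fin n) (Fin n) ℝ) :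
    frobeniusSq (diffMatrix c y + s • w - diffMatrix c z) -
        frobeniusSq (diffMatrix c y + s • w - diffMatrix c y) =
      sqDist c y z + 2 * s * ∑ p : Fin n × Fin n,
        ((c (y p.1) - c (z p.1)) - (c (y p.2) - c (z p.2))) * w p.1 p.2 := by
  simp only [frobeniusSq, sqDist, sq_abs, ← Fintype.sum_prod_type', Finset.mul_sum,
    ← Finset.sum_sub_distrib, ← Finset.sum_add_distrib]
  refine Finset.sum_congr rfl fun p _ => ?_
  simp [diffMatrix]
  ring

/-- The number of vertices on which two colorings differ. -/
def numDiff (y z : Coloring n k) : ℕ := (Finset.univ.filter fun a => z a ≠ y a).card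

/-- Only ordered pairs of one recolored and one unchanged vertex are counted; each contributes a
single squared color gap. Sharp for small `numDiff`, useless when almost every vertex is recolored.
-/
lemma sqDist_ge_of_balanced (c : Fin k → ℝ) (y z : Coloring n k) :
    2 * (numDiff y z : ℝ) * (n - numDiff y z) * minSqGap c ≤ sqDist c y z := by
  classical
  set A := Finset.univ.filter fun a => z a ≠ y a with hA
  have hAc : ((Aᶜ.card : ℕ) : ℝ) = n - numDiff y z := by
    rw [Finset.card_compl, Nat.cast_sub (Finset.card_le_univ _)]
    simp [numDiff, hA]
  have hdisj : Disjoint (A ×ˢ Aᶜ) (Aᶜ ×ˢ A) := by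
    rw [Finset.disjoint_left]
    rintro ⟨a, b⟩ h1 h2
    simp only [Finset.mem_product, Finset.mem_compl] at h1 h2
    exact h2.1 h1.1
  have hmem : ∀ p ∈ (A ×ˢ Aᶜ).disjUnion (Aᶜ ×ˢ A) hdisj,
      minSqGap c ≤ ((c (y p.1) - c (z p.1)) - (c (y p.2) - c (z p.2))) ^ 2 := by
    rintro ⟨a, b⟩ hp
    simp only [Finset.mem_disjUnion, Finset.mem_product, Finset.mem_compl, hA, Finset.mem_filter,
      Finset.mem_univ, true_and, not_not] at hp
    rcases hp with ⟨h1, h2⟩ | ⟨h1, h2⟩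
    · simpa [h2] using minSqGap_le c (Ne.symm h1)
    · simpa [h1] using minSqGap_le c h2
  calc 2 * (numDiff y z : ℝ) * (n - numDiff y z) * minSqGap c
      = ((A ×ˢ Aᶜ).disjUnion (Aᶜ ×ˢ A) hdisj).card • minSqGap c := by
        rw [Finset.card_disjUnion, Finset.card_product, Finset.card_product, nsmul_eq_mul]
        push_cast
        rw [hAc]
        simp only [numDiff, ← hA]
        ring
    _ ≤ _ := Finset.card_nsmul_le_sum _ _ _ hmem
    _ ≤ _ := Finset.sum_le_univ_sum_of_nonneg fun _ => sq_nonneg _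

/-- A vertex whose color drops is compared with the class of the smallest color, whose members
cannot drop, so the two changes never cancel; a rise is compared with the class of the largest
color. Nonempty extreme classes thus rule out a global color shift, which the difference matrix
would not detect. -/
lemma sqDist_ge_of_classSize (c : Fin k → ℝ) (hc : Function.Injective c) (hk : 2 ≤ k)
    (y z : Coloring n k) {N : ℝ} (hN : ∀ i, N ≤ classSize y i) :
    (numDiff y z : ℝ) * (N * minSqGap c) ≤ sqDist c y z := by
  classical
  have : Nonempty (Fin k) := ⟨⟨0, by omega⟩⟩
  obtain ⟨i, hi⟩ := Finite.exists_max c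
  obtain ⟨j, hj⟩ := Finite.exists_min c
  have hm := (minSqGap_pos hk hc).le
  have key : ∀ a, z a ≠ y a → ∀ l : Fin k, (∀ b, y b = l → minSqGap c ≤
      ((c (y a) - c (z a)) - (c (y b) - c (z b))) ^ 2) →
      N * minSqGap c ≤ ∑ b, ((c (y a) - c (z a)) - (c (y b) - c (z b))) ^ 2 := by
    intro a _ l h
    calc N * minSqGap c ≤ classSize y l * minSqGap c := by gcongr; exact hN l
      _ = (Finset.univ.filter fun b => y b = l).card • minSqGap c := by
        rw [nsmul_eq_mul, classSize]
      _ ≤ _ := Finset.card_nsmul_le_sum _ _ _ fun b hb => h b (Finset.mem_filter.1 hb).2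
      _ ≤ _ := Finset.sum_le_univ_sum_of_nonneg fun _ => sq_nonneg _
  rw [sqDist, Fintype.sum_prod_type]
  calc (numDiff y z : ℝ) * (N * minSqGap c)
      = (Finset.univ.filter fun a => z a ≠ y a).card • (N * minSqGap c) := by
        rw [nsmul_eq_mul, numDiff]
    _ ≤ ∑ a ∈ Finset.univ.filter fun a => z a ≠ y a,
          ∑ b, ((c (y a) - c (z a)) - (c (y b) - c (z b))) ^ 2 := by
        refine Finset.card_nsmul_le_sum _ _ _ fun a ha => ?_
        have ha : z a ≠ y a := (Finset.mem_filter.1 ha).2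
        have hsq := minSqGap_le c ha.symm
        rcases lt_or_gt_of_ne (hc.ne ha) with h | h
        · refine key a ha j fun b hb => hsq.trans ?_
          have := hj (z b)
          rw [hb]
          nlinarith
        · refine key a ha i fun b hb => hsq.trans ?_
          have := hi (z b)
          rw [hb]
          nlinarith
    _ ≤ _ := Finset.sum_le_univ_sum_of_nonneg fun _ => Finset.sum_nonneg fun _ _ => sq_nonneg _

variable {Ω : Type*} [MeasurableSpace Ω] {P : Measure Ω} {W : Ω → Matrix (Fin n) (Fin n) ℝ}

lemma measure_loss_le_loss (hW : IsStdGaussianMatrix P W) (c : Fin k → ℝ) (y z : Coloring n k)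
    (s : ℝ) {v : ℝ} (hsv : s ^ 2 ≤ v) :
    P {ω | frobeniusSq (diffMatrix c y + s • W ω - diffMatrix c z) ≤
        frobeniusSq (diffMatrix c y + s • W ω - diffMatrix c y)} ≤
      ENNReal.ofReal (Real.exp (-sqDist c y z / (8 * v))) := by
  have := hW.1.isProbabilityMeasure
  rcases (sqDist_nonneg c y z).eq_or_lt with hq | hq
  · simpa [← hq] using prob_le_one
  -- Without noise the loss gap is exactly `sqDist c y z > 0`; the Gaussian computation below
  -- divides by `s ^ 2`.
  rcases eq_or_ne s 0 with hs | hs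
  · have h : {ω | frobeniusSq (diffMatrix c y + s • W ω - diffMatrix c z) ≤
        frobeniusSq (diffMatrix c y + s • W ω - diffMatrix c y)} = ∅ := by
      ext ω
      have := loss_sub_loss c y z s (W ω)
      rw [hs] at this ⊢
      simp only [Set.mem_ofPred_eq, Set.mem_empty_iff_false, iff_false, not_le]
      linarith
    rw [h]
    simp
  have hlaw := hasLaw_linear hW.1 (fun p => hW.2 p.1 p.2)
    (fun p => -2 * s * ((c (y p.1) - c (z p.1)) - (c (y p.2) - c (z p.2))))
  have hvar : ∑ p : Fin n × Fin n,
      (-2 * s * ((c (y p.1) - c (z p.1)) - (c (y p.2) - c (z p.2)))) ^ 2 =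
      4 * s ^ 2 * sqDist c y z := by
    rw [sqDist, Finset.mul_sum]
    exact Finset.sum_congr rfl fun p _ => by ring
  rw [hvar] at hlaw
  refine le_trans (measure_mono fun ω hω => ?_)
    ((measure_ge_le_of_hasLaw hlaw hq.le).trans (ENNReal.ofReal_le_ofReal ?_))
  · have h := loss_sub_loss c y z s (W ω)
    simp only [Set.mem_ofPred_eq, mul_assoc (-2 * s)] at hω ⊢
    rw [← Finset.mul_sum]
    linarith
  · rw [Real.exp_le_exp, Real.coe_toNNReal _ (by positivity), neg_div, neg_div, neg_le_neg_iff]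
    have hs2 : 0 < s ^ 2 := by positivity
    rw [show sqDist c y z ^ 2 / (2 * (4 * s ^ 2 * sqDist c y z)) = sqDist c y z / (8 * s ^ 2) by
      field_simp; ring]
    gcongr

end Loss

/-! ### The union bound over all colorings. -/

section Achievability

variable {n k : ℕ}

/-- The sum factors over vertices: each keeps its color with weight `1` or takes one of `k - 1`
others with weight `r`. -/
lemma sum_pow_numDiff (y : Coloring n k) (r : ℝ) :
    ∑ z : Coloring n k, r ^ numDiff y z = (1 + (k - 1) * r) ^ n := by
  classical
  have h1 : ∀ z : Coloring n k, r ^ numDiff y z = ∏ a, if z a ≠ y a then r else 1 := fun z => by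
    rw [Finset.prod_ite]
    simp [numDiff]
  have h2 : ∀ a, ∑ i : Fin k, (if i ≠ y a then r else 1) = 1 + (k - 1) * r := fun a => by
    have : ∀ i : Fin k, (if i ≠ y a then r else 1) = (if i = y a then 1 - r else 0) + r := by
      intro i
      split_ifs <;> simp_all
    simp only [this, Finset.sum_add_distrib]
    simp
    ring
  simp only [h1]
  rw [← Fintype.piFinset_univ,
    ← Finset.prod_univ_sum (fun _ => Finset.univ) fun a i => if i ≠ y a then r else 1]
  simp only [h2]
  simp

lemma exp_neg_sqDist_le {c : Fin k → ℝ} (hc : Function.Injective c) (hk : 2 ≤ k)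
    (y z : Coloring n k) (hn : 0 < n) {κ δ L : ℝ} (hκ : 0 < κ) (hδ : 0 < δ) (hδ1 : δ < 1)
    (hL : 0 < L) (hy : ∀ i, κ * n ≤ classSize y i) :
    Real.exp (-sqDist c y z / (8 * ((1 - δ) * n * minSqGap c / (4 * L)))) ≤
      Real.exp (-((1 + δ / 2) * L)) ^ numDiff y z + Real.exp (-(κ * δ / 4 * L)) ^ n := by
  have hm := minSqGap_pos hk hc
  have hn' : (0 : ℝ) < n := by exact_mod_cast hn
  have hδ' : 0 < 1 - δ := by linarith
  have e : -sqDist c y z / (8 * ((1 - δ) * n * minSqGap c / (4 * L))) =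
      -(sqDist c y z * L / (2 * (1 - δ) * n * minSqGap c)) := by
    field_simp
    ring
  rw [e, ← Real.exp_nat_mul, ← Real.exp_nat_mul]
  set h : ℝ := (numDiff y z : ℝ) with hh
  have h0 : 0 ≤ h := Nat.cast_nonneg _
  -- The cut `δn/2` works because `(1 + δ/2)(1 - δ) ≤ 1 - δ/2`.
  rcases le_total h (δ / 2 * n) with hle | hle
  · refine le_trans (Real.exp_le_exp.2 ?_) (le_add_of_nonneg_right (Real.exp_pos _).le)
    rw [mul_neg, neg_le_neg_iff, le_div_iff₀ (by positivity)]
    have h1 := sqDist_ge_of_balanced c y z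
    rw [← hh] at h1
    have h2 : (1 + δ / 2) * (1 - δ) * n ≤ n - h := by nlinarith [mul_pos hn' (sq_pos_of_pos hδ)]
    calc h * ((1 + δ / 2) * L) * (2 * (1 - δ) * n * minSqGap c)
        = 2 * h * ((1 + δ / 2) * (1 - δ) * n) * minSqGap c * L := by ring
      _ ≤ 2 * h * (n - h) * minSqGap c * L := by gcongr
      _ ≤ _ := by gcongr
  · refine le_trans (Real.exp_le_exp.2 ?_) (le_add_of_nonneg_left (Real.exp_pos _).le)
    rw [mul_neg, neg_le_neg_iff, le_div_iff₀ (by positivity)]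
    have h1 := sqDist_ge_of_classSize c hc hk y z hy
    rw [← hh] at h1
    calc n * (κ * δ / 4 * L) * (2 * (1 - δ) * n * minSqGap c)
        = (1 - δ) * ((δ / 2 * n) * (κ * n * minSqGap c) * L) := by ring
      _ ≤ 1 * ((δ / 2 * n) * (κ * n * minSqGap c) * L) := by gcongr; linarith
      _ ≤ h * (κ * n * minSqGap c) * L := by rw [one_mul]; gcongr
      _ ≤ _ := by gcongr

variable {Ω : Type*} [MeasurableSpace Ω] {P : Measure Ω} {W : Ω → Matrix (Fin n) (Fin n) ℝ}

lemma measure_exists_loss_le (hW : IsStdGaussianMatrix P W) {c : Fin k → ℝ}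
    (hc : Function.Injective c) (hk : 2 ≤ k)
    (y : Coloring n k) (hn : 0 < n) {κ δ L s : ℝ} (hκ : 0 < κ) (hδ : 0 < δ) (hδ1 : δ < 1)
    (hL : 0 < L) (hy : ∀ i, κ * n ≤ classSize y i)
    (hs : s ^ 2 ≤ (1 - δ) * n * minSqGap c / (4 * L)) :
    P {ω | ∃ z, z ≠ y ∧ frobeniusSq (diffMatrix c y + s • W ω - diffMatrix c z) ≤
        frobeniusSq (diffMatrix c y + s • W ω - diffMatrix c y)} ≤
      ENNReal.ofReal ((1 + (k - 1) * Real.exp (-((1 + δ / 2) * L))) ^ n - 1 +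
        (k * Real.exp (-(κ * δ / 4 * L))) ^ n) := by
  classical
  set r := Real.exp (-((1 + δ / 2) * L)) with hr
  set t := Real.exp (-(κ * δ / 4 * L)) with ht
  have hr0 : 0 < r := Real.exp_pos _
  have ht0 : 0 < t := Real.exp_pos _
  calc _ ≤ P (⋃ z ∈ Finset.univ.erase y,
        {ω | frobeniusSq (diffMatrix c y + s • W ω - diffMatrix c z) ≤
          frobeniusSq (diffMatrix c y + s • W ω - diffMatrix c y)}) := by
        refine measure_mono fun ω hω => ?_
        obtain ⟨z, hz, h⟩ := hω
        simp only [Set.mem_iUnion]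
        exact ⟨z, by simpa using hz, h⟩
    _ ≤ ∑ z ∈ Finset.univ.erase y, P {ω | frobeniusSq (diffMatrix c y + s • W ω - diffMatrix c z) ≤
          frobeniusSq (diffMatrix c y + s • W ω - diffMatrix c y)} :=
        measure_biUnion_finset_le _ _
    _ ≤ ∑ z ∈ Finset.univ.erase y, ENNReal.ofReal (r ^ numDiff y z + t ^ n) := by
        refine Finset.sum_le_sum fun z _ => (measure_loss_le_loss hW c y z s hs).trans
          (ENNReal.ofReal_le_ofReal (exp_neg_sqDist_le hc hk y z hn hκ hδ hδ1 hL hy))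
    _ = ENNReal.ofReal (∑ z ∈ Finset.univ.erase y, (r ^ numDiff y z + t ^ n)) :=
        (ENNReal.ofReal_sum_of_nonneg fun z _ => by positivity).symm
    _ ≤ _ := by
        refine ENNReal.ofReal_le_ofReal ?_
        rw [Finset.sum_add_distrib, Finset.sum_erase_eq_sub (Finset.mem_univ y), sum_pow_numDiff]
        have h1 : numDiff y y = 0 := by simp [numDiff]
        have h2 : ∑ _z ∈ Finset.univ.erase y, t ^ n ≤ (k * t) ^ n := by
          refine (Finset.sum_le_univ_sum_of_nonneg fun _ => by positivity).trans_eq ?_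
          simp [mul_pow]
        rw [h1, pow_zero]
        linarith

lemma tendsto_union_bound (k : ℕ) (hk : 2 ≤ k) {δ κ : ℝ} (hδ : 0 < δ) (hκ : 0 < κ) :
    Tendsto (fun n : ℕ => (1 + ((k : ℝ) - 1) * Real.exp (-((1 + δ / 2) * Real.log n))) ^ n - 1 +
      (k * Real.exp (-(κ * δ / 4 * Real.log n))) ^ n) atTop (𝓝 0) := by
  have hlog : Tendsto (fun n : ℕ => Real.log n) atTop atTop :=
    Real.tendsto_log_atTop.comp tendsto_natCast_atTop_atTop
  have hexp : ∀ a : ℝ, 0 < a → Tendsto (fun n : ℕ => Real.exp (-(a * Real.log n))) atTop (𝓝 0) :=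
    fun a ha => Real.tendsto_exp_neg_atTop_nhds_zero.comp (hlog.const_mul_atTop ha)
  have hk1 : (0 : ℝ) ≤ (k : ℝ) - 1 := by
    have : (2 : ℝ) ≤ k := by exact_mod_cast hk
    linarith
  rw [show (0 : ℝ) = 0 + 0 by simp]
  refine Tendsto.add ?_ ?_
  · have hup : Tendsto (fun n : ℕ => Real.exp (((k : ℝ) - 1) * Real.exp (-(δ / 2 * Real.log n))) - 1)
        atTop (𝓝 0) := by
      have := (Real.continuous_exp.tendsto _).comp ((hexp (δ / 2) (by positivity)).const_mul
        ((k : ℝ) - 1))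
      simpa using this.sub_const 1
    refine tendsto_of_tendsto_of_tendsto_of_le_of_le' tendsto_const_nhds hup
      (Eventually.of_forall fun n => ?_) ?_
    · have : 0 ≤ ((k : ℝ) - 1) * Real.exp (-((1 + δ / 2) * Real.log n)) := by positivity
      exact sub_nonneg.2 (one_le_pow₀ (by linarith))
    · filter_upwards [eventually_gt_atTop 0] with n hn
      have hn' : (0 : ℝ) < n := by exact_mod_cast hn
      refine sub_le_sub_right ?_ 1
      calc _ ≤ Real.exp (((k : ℝ) - 1) * Real.exp (-((1 + δ / 2) * Real.log n))) ^ n := by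
            gcongr
            rw [add_comm]
            exact Real.add_one_le_exp _
        -- The factor `n` from the power turns `n^(-1-δ/2)` into `n^(-δ/2)`.
        _ = _ := by
            rw [← Real.exp_nat_mul, show -((1 + δ / 2) * Real.log n) =
              -(δ / 2 * Real.log n) - Real.log n by ring, Real.exp_sub, Real.exp_log hn']
            congr 1
            field_simp
  · have hz : Tendsto (fun n : ℕ => (1 / 2 : ℝ) ^ n) atTop (𝓝 0) :=
      tendsto_pow_atTop_nhds_zero_of_lt_one (by norm_num) (by norm_num)
    have h0 := (hexp (κ * δ / 4) (by positivity)).const_mul (k : ℝ)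
    rw [mul_zero] at h0
    refine tendsto_of_tendsto_of_tendsto_of_le_of_le' tendsto_const_nhds hz
      (Eventually.of_forall fun n => by positivity) ?_
    filter_upwards [h0.eventually_lt_const (show (0 : ℝ) < 1 / 2 by norm_num)] with n hn
    gcongr

end Achievability

/-! ### Exact recovery below the threshold. -/

section

variable {k : ℕ} {c : Fin k → ℝ} {y : ∀ n : ℕ, Coloring n k} {κ : ℝ} {σ : ℕ → ℝ}
  {Ω : ℕ → Type*} [∀ n, MeasurableSpace (Ω n)] {P : ∀ n, Measure (Ω n)}
  {W : ∀ n, Ω n → Matrix (Fin n) (Fin n) ℝ}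

/-- Below the threshold, with high probability the true coloring is the only minimizer. -/
lemma tendsto_measure_exists_loss_le (hk : 2 ≤ k) (hc : Function.Injective c) (hκ : 0 < κ)
    (hy : ∀ᶠ n : ℕ in atTop, ∀ i : Fin k, κ * (n : ℝ) ≤ (classSize (y n) i : ℝ))
    (hW : ∀ n, IsStdGaussianMatrix (P n) (W n)) {δ : ℝ} (hδ : 0 < δ)
    (hσ : ∀ᶠ n : ℕ in atTop,
      σ n ^ 2 < (1 - δ) * (n : ℝ) * minSqGap c / (4 * Real.log (n : ℝ))) :
    Tendsto (fun n => P n {ω | ∃ z, z ≠ y n ∧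
      frobeniusSq (diffMatrix c (y n) + σ n • W n ω - diffMatrix c z) ≤
        frobeniusSq (diffMatrix c (y n) + σ n • W n ω - diffMatrix c (y n))}) atTop (𝓝 0) := by
  have hb := ENNReal.tendsto_ofReal (tendsto_union_bound k hk hδ hκ)
  rw [ENNReal.ofReal_zero] at hb
  refine tendsto_of_tendsto_of_tendsto_of_le_of_le' tendsto_const_nhds hb
    (Eventually.of_forall fun _ => zero_le) ?_
  filter_upwards [hy, hσ, eventually_gt_atTop 1] with n hyn hσn hn
  have hn' : (1 : ℝ) < n := by exact_mod_cast hn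
  have hL := Real.log_pos hn'
  have hm := minSqGap_pos hk hc
  -- Otherwise the threshold would be nonpositive and `σ n ^ 2` could not lie below it.
  have hδ1 : δ < 1 := by
    by_contra! h
    have : (1 - δ) * (n : ℝ) * minSqGap c / (4 * Real.log (n : ℝ)) ≤ 0 :=
      div_nonpos_of_nonpos_of_nonneg (mul_nonpos_of_nonpos_of_nonneg
        (mul_nonpos_of_nonpos_of_nonneg (by linarith) (by positivity)) hm.le) (by positivity)
    nlinarith [sq_nonneg (σ n)]
  exact measure_exists_loss_le (hW n) hc hk (y n) (by omega) hκ hδ hδ1 hL hyn hσn.le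

/-- Subadditivity alone is used, so the estimator need not be measurable; the bad event includes
ties. -/
lemma tendsto_measure_eq_of_isMLE [∀ n, IsProbabilityMeasure (P n)] {S : ∀ n, Set (Coloring n k)} (hyS : ∀ n, y n ∈ S n)
    {T : ∀ n, Ω n → Matrix (Fin n) (Fin n) ℝ} {x : ∀ n, Ω n → Coloring n k}
    (hx : ∀ n ω, IsMLE c (S n) (T n ω) (x n ω))
    (h : Tendsto (fun n => P n {ω | ∃ z, z ≠ y n ∧ frobeniusSq (T n ω - diffMatrix c z) ≤
      frobeniusSq (T n ω - diffMatrix c (y n))}) atTop (𝓝 0)) :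
    Tendsto (fun n => P n {ω | x n ω = y n}) atTop (𝓝 1) := by
  have h1 := ENNReal.Tendsto.sub (tendsto_const_nhds (x := (1 : ENNReal))) h (by simp)
  rw [tsub_zero] at h1
  refine tendsto_of_tendsto_of_tendsto_of_le_of_le h1 tendsto_const_nhds (fun n => ?_)
    fun n => prob_le_one
  rw [tsub_le_iff_right, ← measure_univ (μ := P n)]
  refine (measure_mono fun ω _ => ?_).trans (measure_union_le _ _)
  by_cases hxy : x n ω = y n
  · exact Or.inl hxy
  · exact Or.inr ⟨x n ω, hxy, (hx n ω).2 (hyS n)⟩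

end

/-! ### Swaps and extremes of row-minus-column sums. -/

section Converse

variable {n k : ℕ}

/-- For iid standard Gaussian variables, the maximum over a finite set exceeds any given level
up to a probability that is exponentially small in the number of variables. -/
lemma measure_forall_le {Ω J : Type*} [MeasurableSpace Ω] {P : Measure Ω} {Z : J → Ω → ℝ}
    (hind : iIndepFun Z P) (hlaw : ∀ j, HasLaw (Z j) (gaussianReal 0 1) P) (s : Finset J)
    {t : ℝ} (ht : 0 ≤ t) :
    P {ω | ∀ j ∈ s, Z j ω ≤ t} ≤ ENNReal.ofReal
      (Real.exp (-(s.card * ((√(2 * Real.pi))⁻¹ * Real.exp (-(t + 1) ^ 2 / 2))))) := by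
  set q := (√(2 * Real.pi))⁻¹ * Real.exp (-(t + 1) ^ 2 / 2) with hq
  have hset : {ω | ∀ j ∈ s, Z j ω ≤ t} = ⋂ j ∈ s, Z j ⁻¹' Set.Iic t := by
    ext ω
    simp
  have hone : gaussianReal 0 1 (Set.Iic t) ≤ ENNReal.ofReal (Real.exp (-q)) := by
    have h1 : gaussianReal 0 1 (Set.Iic t) ≤ 1 - ENNReal.ofReal q := by
      rw [← Set.compl_Ioi, prob_compl_eq_one_sub measurableSet_Ioi]
      exact tsub_le_tsub_left (gaussianReal_Ioi_ge ht) 1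
    refine h1.trans ?_
    rw [← ENNReal.ofReal_one, ← ENNReal.ofReal_sub _ (by positivity)]
    refine ENNReal.ofReal_le_ofReal ?_
    have := Real.add_one_le_exp (-q)
    linarith
  rw [hset, hind.measure_inter_preimage_eq_mul s fun _ _ => measurableSet_Iic]
  calc ∏ j ∈ s, P (Z j ⁻¹' Set.Iic t) = ∏ _j ∈ s, gaussianReal 0 1 (Set.Iic t) :=
        Finset.prod_congr rfl fun j _ => (hlaw j).measure_eq (p := fun x => x ≤ t) measurableSet_Iic
    _ = gaussianReal 0 1 (Set.Iic t) ^ s.card := by simp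
    _ ≤ ENNReal.ofReal (Real.exp (-q)) ^ s.card := by gcongr
    _ = _ := by
        rw [← ENNReal.ofReal_pow (Real.exp_pos _).le, ← Real.exp_nat_mul, mul_neg]

/-- The coefficients of `p`-th row sum minus `p`-th column sum, shifted by a multiple of the
diagonal entry at `o` that makes these vectors orthogonal for different `p`. -/
noncomputable def rowColCoeff (o p : Fin n) (i : Fin n × Fin n) : ℝ :=
  (if i.1 = p then 1 else 0) - (if i.2 = p then 1 else 0) +
    √2 * ((if i.1 = o then 1 else 0) * (if i.2 = o then 1 else 0))

/-- Unshifted, the vectors have squared norm `2n - 2` and mutual inner product `-2`, from the cells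
`(p, q)` and `(q, p)`. All vanish on the diagonal, so an entry `√2` at `(o, o)` adds exactly `2` to
every inner product. -/
lemma sum_rowColCoeff_mul (o p q : Fin n) :
    ∑ i, rowColCoeff o p i * rowColCoeff o q i = if p = q then 2 * (n : ℝ) else 0 := by
  have h2 : √2 * √2 = 2 := Real.mul_self_sqrt (by norm_num)
  have key : ∀ i j : Fin n, rowColCoeff o p (i, j) * rowColCoeff o q (i, j) =
      (if i = p then (1 : ℝ) else 0) * (if i = q then 1 else 0) * 1
      + 1 * ((if j = p then 1 else 0) * (if j = q then 1 else 0))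
      - (if i = p then 1 else 0) * (if j = q then 1 else 0)
      - (if i = q then 1 else 0) * (if j = p then 1 else 0)
      + √2 * ((if i = o then 1 else 0) * (if i = p then 1 else 0) * (if j = o then 1 else 0)
        + (if i = o then 1 else 0) * (if i = q then 1 else 0) * (if j = o then 1 else 0)
        - (if i = o then 1 else 0) * ((if j = o then 1 else 0) * (if j = p then 1 else 0))
        - (if i = o then 1 else 0) * ((if j = o then 1 else 0) * (if j = q then 1 else 0)))
      + 2 * ((if i = o then 1 else 0) * (if j = o then 1 else 0)) := by
    intro i j
    have hi : (if i = o then (1 : ℝ) else 0) ^ 2 = if i = o then 1 else 0 := by split_ifs <;> simp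
    have hj : (if j = o then (1 : ℝ) else 0) ^ 2 = if j = o then 1 else 0 := by split_ifs <;> simp
    simp only [rowColCoeff]
    linear_combination (√2 * √2 * (if j = o then (1 : ℝ) else 0) ^ 2) * hi
      + (√2 * √2 * (if i = o then (1 : ℝ) else 0)) * hj
      + ((if i = o then (1 : ℝ) else 0) * (if j = o then 1 else 0)) * h2
  rw [Fintype.sum_prod_type]
  simp only [key, Finset.sum_add_distrib, Finset.sum_sub_distrib, ← Finset.mul_sum,
    ← Finset.sum_mul]
  rcases eq_or_ne p q with h | h
  · subst h
    simp
    ring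
  · simp [h, h.symm]
    norm_num

lemma rowColCoeff_sub (o a b : Fin n) (i : Fin n × Fin n) :
    rowColCoeff o a i - rowColCoeff o b i =
      ((if i.1 = a then 1 else 0) - (if i.1 = b then 1 else 0)) -
        ((if i.2 = a then 1 else 0) - (if i.2 = b then 1 else 0)) := by
  simp only [rowColCoeff]
  ring

lemma classSize_comp_swap (y : Coloring n k) (a b : Fin n) :
    classSize (y ∘ Equiv.swap a b) = classSize y := by
  ext i
  exact Finset.card_equiv (Equiv.swap a b) (by simp)

lemma sub_comp_swap (c : Fin k → ℝ) (y : Coloring n k) (a b p : Fin n) :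
    c (y p) - c ((y ∘ Equiv.swap a b) p) =
      (c (y a) - c (y b)) * ((if p = a then 1 else 0) - (if p = b then 1 else 0)) := by
  by_cases h1 : p = a
  · subst h1
    by_cases h2 : p = b
    · subst h2; simp
    · simp [h2]
  · by_cases h2 : p = b
    · subst h2; simp [h1]
    · simp [h1, h2, Equiv.swap_apply_of_ne_of_ne h1 h2]

lemma sqDist_comp_swap (c : Fin k → ℝ) (y : Coloring n k) {a b : Fin n} (hab : a ≠ b) :
    sqDist c y (y ∘ Equiv.swap a b) = 4 * n * (c (y a) - c (y b)) ^ 2 := by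
  have key : ∀ p : Fin n × Fin n, ((c (y p.1) - c ((y ∘ Equiv.swap a b) p.1)) -
      (c (y p.2) - c ((y ∘ Equiv.swap a b) p.2))) ^ 2 = (c (y a) - c (y b)) ^ 2 *
      (rowColCoeff a a p * rowColCoeff a a p + rowColCoeff a b p * rowColCoeff a b p
        - 2 * (rowColCoeff a a p * rowColCoeff a b p)) := by
    intro p
    rw [sub_comp_swap, sub_comp_swap, ← mul_sub, ← rowColCoeff_sub a]
    ring
  simp only [sqDist, key, ← Finset.mul_sum, Finset.sum_sub_distrib, Finset.sum_add_distrib,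
    sum_rowColCoeff_mul]
  simp [hab]
  ring

lemma loss_swap_sub_loss (c : Fin k → ℝ) (y : Coloring n k) (s : ℝ)
    (w : Matrix (Fin n) (Fin n) ℝ) (o : Fin n) {a b : Fin n} (hab : a ≠ b) :
    frobeniusSq (diffMatrix c y + s • w - diffMatrix c (y ∘ Equiv.swap a b)) -
        frobeniusSq (diffMatrix c y + s • w - diffMatrix c y) =
      4 * n * (c (y a) - c (y b)) ^ 2 + 2 * s * (c (y a) - c (y b)) *
        (∑ i, rowColCoeff o a i * w i.1 i.2 - ∑ i, rowColCoeff o b i * w i.1 i.2) := by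
  rw [loss_sub_loss, sqDist_comp_swap c y hab, ← Finset.sum_sub_distrib, mul_assoc (2 * s),
    Finset.mul_sum _ _ (c (y a) - c (y b))]
  congr 2
  refine Finset.sum_congr rfl fun p _ => ?_
  rw [sub_comp_swap, sub_comp_swap, ← sub_mul, ← mul_sub, ← rowColCoeff_sub o]
  ring

variable {Ω : Type*} [MeasurableSpace Ω] {P : Measure Ω} {W : Ω → Matrix (Fin n) (Fin n) ℝ}

/-- The maximal (or, for `e = -1`, minimal) normalized difference of row and column sums. -/
lemma measure_forall_rowCol_le (hW : IsStdGaussianMatrix P W) (o : Fin n) {e : ℝ}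
    (he : e ^ 2 = 1) (s : Finset (Fin n)) {t N : ℝ} (ht : 0 ≤ t) (hN : N ≤ s.card) :
    P {ω | ∀ p ∈ s, e * ∑ i, rowColCoeff o p i * W ω i.1 i.2 ≤ √(2 * n) * t} ≤ ENNReal.ofReal
      (Real.exp (-(N * ((√(2 * Real.pi))⁻¹ * Real.exp (-(t + 1) ^ 2 / 2))))) := by
  have hn : (0 : ℝ) < n := by exact_mod_cast o.pos
  have h2n : 0 < √(2 * (n : ℝ)) := by positivity
  have hsq : √(2 * (n : ℝ)) ^ 2 = 2 * n := Real.sq_sqrt (by positivity)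
  have hdot : ∀ p q : Fin n, ∑ i, (e / √(2 * n) * rowColCoeff o p i) *
      (e / √(2 * n) * rowColCoeff o q i) = if p = q then 1 else 0 := by
    intro p q
    have : ∀ i, (e / √(2 * n) * rowColCoeff o p i) * (e / √(2 * n) * rowColCoeff o q i) =
        (e ^ 2 / √(2 * n) ^ 2) * (rowColCoeff o p i * rowColCoeff o q i) := fun i => by ring
    simp only [this, ← Finset.mul_sum, sum_rowColCoeff_mul, he, hsq]
    split_ifs
    · field_simp
    · simp
  have hlaw0 := fun p : Fin n × Fin n => hW.2 p.1 p.2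
  have hind := iIndepFun_linear hW.1 hlaw0 (fun (p : Fin n) i => e / √(2 * n) * rowColCoeff o p i)
    fun p q hpq => by rw [hdot, if_neg hpq]
  have hlaw : ∀ p : Fin n, HasLaw (fun ω => ∑ i, e / √(2 * n) * rowColCoeff o p i * W ω i.1 i.2)
      (gaussianReal 0 1) P := fun p => by
    have h := hasLaw_linear hW.1 hlaw0 (fun i => e / √(2 * n) * rowColCoeff o p i)
    simp only [sq, hdot] at h
    simpa using h
  refine le_trans (measure_mono fun ω hω => ?_) ((measure_forall_le hind hlaw s ht).trans
    (ENNReal.ofReal_le_ofReal (Real.exp_le_exp.2 (neg_le_neg ?_))))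
  · intro p hp
    have h := hω p hp
    simp only [mul_assoc, ← Finset.mul_sum]
    rw [div_mul_eq_mul_div, div_le_iff₀ h2n]
    linarith
  · gcongr

lemma measure_forall_swap_le (hW : IsStdGaussianMatrix P W) (c : Fin k → ℝ)
    (y : Coloring n k) {i j : Fin k} (hij : c i ≠ c j) (hn : 0 < n) {N s t : ℝ}
    (hi : N ≤ classSize y i) (hj : N ≤ classSize y j) (ht : 0 ≤ t)
    (hs : n * (c i - c j) ^ 2 ≤ 2 * s ^ 2 * t ^ 2) :
    P {ω | ∀ z ∈ fixedSizes n (classSize y),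
        frobeniusSq (diffMatrix c y + s • W ω - diffMatrix c y) ≤
          frobeniusSq (diffMatrix c y + s • W ω - diffMatrix c z)} ≤
      2 * ENNReal.ofReal
        (Real.exp (-(N * ((√(2 * Real.pi))⁻¹ * Real.exp (-(t + 1) ^ 2 / 2))))) := by
  let o : Fin n := ⟨0, hn⟩
  have hn' : (0 : ℝ) < n := by exact_mod_cast hn
  set g := c i - c j with hg
  have hg0 : g ≠ 0 := sub_ne_zero.2 hij
  -- The sign `e` is opposite to that of `s * g`: it decides which class needs a large row-column
  -- sum and which a small one.
  obtain ⟨e, he, hes⟩ : ∃ e : ℝ, e ^ 2 = 1 ∧ -(s * g) = |s * g| * e := by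
    rcases le_total 0 (s * g) with h | h
    · exact ⟨-1, by norm_num, by rw [abs_of_nonneg h]; ring⟩
    · exact ⟨1, by norm_num, by rw [abs_of_nonpos h]; ring⟩
  have hlevel : n * g ^ 2 ≤ |s * g| * (√(2 * n) * t) := by
    refine le_of_sq_le_sq ?_ (by positivity)
    rw [mul_pow |s * g|, mul_pow _ t, sq_abs, Real.sq_sqrt (by positivity)]
    have := mul_le_mul_of_nonneg_left hs (show 0 ≤ (n : ℝ) * g ^ 2 by positivity)
    nlinarith
  have hsg : 0 < |s * g| := by
    refine (abs_nonneg _).lt_of_ne fun h => ?_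
    rw [← h] at hlevel
    have : 0 < n * g ^ 2 := by positivity
    linarith
  rw [two_mul]
  refine le_trans (measure_mono fun ω hω => ?_) ((measure_union_le _ _).trans (add_le_add
    (measure_forall_rowCol_le hW o he (Finset.univ.filter fun a => y a = i) ht hi)
    (measure_forall_rowCol_le hW o (e := -e) (by rw [neg_sq, he])
      (Finset.univ.filter fun a => y a = j) ht hj)))
  -- Otherwise some `a` and `b` both exceed the level, and `hlevel` makes the swap strictly better
  -- than `y`.
  by_contra hcon
  simp only [Set.mem_union, Set.mem_ofPred_eq, not_or, not_forall, not_le, Finset.mem_filter,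
    Finset.mem_univ, true_and, exists_prop] at hcon
  obtain ⟨⟨a, ha, hla⟩, ⟨b, hb, hlb⟩⟩ := hcon
  have hab : a ≠ b := by
    rintro rfl
    exact hij (by rw [← ha, ← hb])
  have h := hω (y ∘ Equiv.swap a b) fun l => by rw [classSize_comp_swap]
  have h2 := loss_swap_sub_loss c y s (W ω) o hab
  rw [ha, hb, ← hg] at h2
  set x := ∑ i, rowColCoeff o a i * W ω i.1 i.2
  set x' := ∑ i, rowColCoeff o b i * W ω i.1 i.2
  have h3 := mul_lt_mul_of_pos_left hla hsg
  have h4 := mul_lt_mul_of_pos_left hlb hsg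
  have h5 : s * g * (x - x') = -(|s * g| * (e * x) + |s * g| * (-e * x')) := by
    linear_combination (x' - x) * hes
  nlinarith

lemma tendsto_swap_bound {κ δ : ℝ} (hκ : 0 < κ) (hδ : 0 < δ) :
    Tendsto (fun n : ℕ => Real.exp (-(κ * n * ((√(2 * Real.pi))⁻¹ *
      Real.exp (-(√(2 * Real.log n / (1 + δ)) + 1) ^ 2 / 2))))) atTop (𝓝 0) := by
  have hlog : Tendsto (fun n : ℕ => Real.log n) atTop atTop :=
    Real.tendsto_log_atTop.comp tendsto_natCast_atTop_atTop
  have hu : Tendsto (fun n : ℕ => √(2 * Real.log n / (1 + δ))) atTop atTop :=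
    Real.tendsto_sqrt_atTop.comp
      ((hlog.const_mul_atTop (by norm_num : (0 : ℝ) < 2)).atTop_div_const (by positivity))
  -- With `u² = 2 log n / (1 + δ)`, this polynomial is `log n - (u + 1)²/2`; the leading term
  -- `δu²/2` is the slack above the threshold.
  have hpoly : Tendsto (fun u : ℝ => u * (δ / 2 * u + (-1)) + (-1 / 2)) atTop atTop :=
    tendsto_atTop_add_const_right _ _ (tendsto_id.atTop_mul_atTop₀
      (tendsto_atTop_add_const_right _ _ (tendsto_id.const_mul_atTop (by positivity))))
  have hmain := ((Real.tendsto_exp_atTop.comp (hpoly.comp hu)).const_mul_atTop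
    (show 0 < κ * (√(2 * Real.pi))⁻¹ by positivity))
  refine (Real.tendsto_exp_neg_atTop_nhds_zero.comp hmain).congr' ?_
  filter_upwards [eventually_gt_atTop 1] with n hn
  have hn' : (1 : ℝ) < n := by exact_mod_cast hn
  have hL := Real.log_pos hn'
  simp only [Function.comp_apply]
  set u := √(2 * Real.log n / (1 + δ)) with hu'
  have hsq : u ^ 2 = 2 * Real.log n / (1 + δ) := Real.sq_sqrt (by positivity)
  have hlogu : Real.log n = (1 + δ) / 2 * u ^ 2 := by
    rw [hsq]
    field_simp
  have : u * (δ / 2 * u + (-1)) + (-1 / 2) = Real.log n + (-(u + 1) ^ 2 / 2) := by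
    rw [hlogu]
    ring
  rw [this, Real.exp_add, Real.exp_log (by linarith)]
  congr 1
  ring

end Converse

/-! ### Failure of recovery above the threshold. -/

section

variable {k : ℕ} {c : Fin k → ℝ} {y : ∀ n : ℕ, Coloring n k} {κ : ℝ} {σ : ℕ → ℝ}
  {Ω : ℕ → Type*} [∀ n, MeasurableSpace (Ω n)] {P : ∀ n, Measure (Ω n)}
  {W : ∀ n, Ω n → Matrix (Fin n) (Fin n) ℝ}

/-- Above the threshold, with high probability the true coloring does not minimize the loss
even among the colorings with the true class sizes. -/
lemma tendsto_measure_forall_loss_le (hk : 2 ≤ k) (hc : Function.Injective c) (hκ : 0 < κ)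
    (hy : ∀ᶠ n : ℕ in atTop, ∀ i : Fin k, κ * (n : ℝ) ≤ (classSize (y n) i : ℝ))
    (hW : ∀ n, IsStdGaussianMatrix (P n) (W n)) {δ : ℝ} (hδ : 0 < δ)
    (hσ : ∀ᶠ n : ℕ in atTop,
      σ n ^ 2 > (1 + δ) * (n : ℝ) * minSqGap c / (4 * Real.log (n : ℝ))) :
    Tendsto (fun n => P n {ω | ∀ z ∈ fixedSizes n (classSize (y n)),
      frobeniusSq (diffMatrix c (y n) + σ n • W n ω - diffMatrix c (y n)) ≤
        frobeniusSq (diffMatrix c (y n) + σ n • W n ω - diffMatrix c z)}) atTop (𝓝 0) := by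
  obtain ⟨i, j, hij, hm⟩ := exists_minSqGap_eq hk c
  have hb := ENNReal.Tendsto.const_mul (a := 2)
    (ENNReal.tendsto_ofReal (tendsto_swap_bound hκ hδ)) (Or.inr (by simp))
  rw [ENNReal.ofReal_zero, mul_zero] at hb
  refine tendsto_of_tendsto_of_tendsto_of_le_of_le' tendsto_const_nhds hb
    (Eventually.of_forall fun _ => zero_le) ?_
  filter_upwards [hy, hσ, eventually_gt_atTop 1] with n hyn hσn hn
  have hn' : (1 : ℝ) < n := by exact_mod_cast hn
  have hL := Real.log_pos hn'
  refine measure_forall_swap_le (hW n) c (y n) (hc.ne hij) (by omega) (hyn i) (hyn j)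
    (Real.sqrt_nonneg _) ?_
  rw [gt_iff_lt, div_lt_iff₀ (by positivity), hm] at hσn
  rw [Real.sq_sqrt (by positivity), mul_div_assoc', le_div_iff₀ (by positivity)]
  linarith

end

end ColorRecovery

theorem theorem1
    -- at least two distinct real colors, fixed as the number `n` of vertices grows
    (k : ℕ) (hk : 2 ≤ k) (c : Fin k → ℝ) (hc : Function.Injective c)
    -- the true colorings; each class has at least `κ * n` vertices
    (y : ∀ n : ℕ, ColorRecovery.Coloring n k) (κ : ℝ) (hκ : 0 < κ)
    (hy : ∀ᶠ n : ℕ in atTop, ∀ i : Fin k, κ * (n : ℝ) ≤ (ColorRecovery.classSize (y n) i : ℝ))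
    -- the noise level, which may depend on `n`, and the noise
    (σ : ℕ → ℝ)
    {Ω : ℕ → Type*} [∀ n, MeasurableSpace (Ω n)] (P : ∀ n, Measure (Ω n))
    [∀ n, IsProbabilityMeasure (P n)]
    (W : ∀ n, Ω n → Matrix (Fin n) (Fin n) ℝ)
    (hW : ∀ n, ColorRecovery.IsStdGaussianMatrix (P n) (W n))
    -- the observation
    (T : ∀ n, Ω n → Matrix (Fin n) (Fin n) ℝ)
    (hT : ∀ n ω, T n ω = ColorRecovery.diffMatrix c (y n) + σ n • W n ω)
    -- the estimator over the colorings with the true class sizes, ties broken arbitrarily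
    (yhat : ∀ n, Ω n → ColorRecovery.Coloring n k)
    (hyhat : ∀ n ω, ColorRecovery.IsMLE c
      (ColorRecovery.fixedSizes n (ColorRecovery.classSize (y n))) (T n ω) (yhat n ω))
    -- the estimator over all colorings, ties broken arbitrarily
    (ycheck : ∀ n, Ω n → ColorRecovery.Coloring n k)
    (hycheck : ∀ n ω, ColorRecovery.IsMLE c Set.univ (T n ω) (ycheck n ω)) :
    ((∃ δ : ℝ, 0 < δ ∧ ∀ᶠ n : ℕ in atTop,
        σ n ^ 2 < (1 - δ) * (n : ℝ) * ColorRecovery.minSqGap c / (4 * Real.log (n : ℝ))) →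
      Tendsto (fun n => P n {ω | yhat n ω = y n}) atTop (𝓝 1) ∧
      Tendsto (fun n => P n {ω | ycheck n ω = y n}) atTop (𝓝 1)) ∧
    ((∃ δ : ℝ, 0 < δ ∧ ∀ᶠ n : ℕ in atTop,
        σ n ^ 2 > (1 + δ) * (n : ℝ) * ColorRecovery.minSqGap c / (4 * Real.log (n : ℝ))) →
      Tendsto (fun n => P n {ω | yhat n ω = y n}) atTop (𝓝 0) ∧
      Tendsto (fun n => P n {ω | ycheck n ω = y n}) atTop (𝓝 0)) := by
  constructor
  · rintro ⟨δ, hδ, hσ⟩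
    have h := ColorRecovery.tendsto_measure_exists_loss_le hk hc hκ hy hW hδ hσ
    simp only [← hT] at h
    exact ⟨ColorRecovery.tendsto_measure_eq_of_isMLE (fun n => show y n ∈
      ColorRecovery.fixedSizes n (ColorRecovery.classSize (y n)) from fun _ => rfl) hyhat h,
      ColorRecovery.tendsto_measure_eq_of_isMLE (fun n => Set.mem_univ _) hycheck h⟩
  · rintro ⟨δ, hδ, hσ⟩
    have h := ColorRecovery.tendsto_measure_forall_loss_le hk hc hκ hy hW hδ hσ
    simp only [← hT] at h
    -- If either estimator returns `y n`, then `y n` is a minimizer among colorings with its class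
    -- sizes; for `ycheck` this follows by restriction.
    refine ⟨tendsto_of_tendsto_of_tendsto_of_le_of_le tendsto_const_nhds h (fun _ => zero_le)
        fun n => measure_mono fun ω hω z hz => ?_,
      tendsto_of_tendsto_of_tendsto_of_le_of_le tendsto_const_nhds h (fun _ => zero_le)
        fun n => measure_mono fun ω hω z _ => ?_⟩
    · have hω : yhat n ω = y n := hω
      exact hω ▸ (hyhat n ω).2 hz
    · have hω : ycheck n ω = y n := hω
      exact hω ▸ (hycheck n ω).2 (Set.mem_univ z)
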